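/- Let $G$ be a finite group and let $p$ be a prime dividing $|G|$. Let $\mathcal S_p(G)$ be the set of nontrivial $p$-subgroups of $G$, partially ordered by inclusion, and let $|\mathcal S_p(G)|$ be the geometric realization of its order complex, i.e. of the simplicial complex whose simplices are the nonempty finite chains $P_0<\cdots<P_n$ in $\mathcal S_p(G)$. The group $G$ acts on $\mathcal S_p(G)$ by conjugation, $g\cdot P=gPg^{-1}$, and hence on $|\mathcal S_p(G)|$ by homeomorphisms that are affine on each simplex. Then the orbit space $|\mathcal S_p(G)|/G$, with the quotient topology, is contractible. -/

import Mathlib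

open scoped Pointwise

/-- The order complex of a partially ordered set: the abstract simplicial complex whose simplices
are the nonempty finite chains. -/
def orderComplex (S : Type*) [PartialOrder S] : AbstractSimplicialComplex S where
  faces := {s | s.Nonempty ∧ IsChain (· ≤ ·) (s : Set S)}
  isRelLowerSet_faces := fun _ hs =>
    ⟨hs.1, fun _ hts ht => ⟨ht, hs.2.mono (Finset.coe_subset.mpr hts)⟩⟩
  singleton_mem := fun v => ⟨Finset.singleton_nonempty v, by simp⟩

/-- The geometric realization of an abstract simplicial complex `K` on a finite vertex set: the
points of the standard simplex on the vertices (barycentric coordinates) which are supported on a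
simplex of `K`, with the topology of a subspace of the finite-dimensional space `ι → ℝ`. -/
def geometricRealization {ι : Type*} [Fintype ι] (K : AbstractSimplicialComplex ι) : Type _ :=
  {x : ι → ℝ // x ∈ stdSimplex ℝ ι ∧ ∃ s ∈ K.faces, Function.support x ⊆ (s : Set ι)}

instance geometricRealization.instTopologicalSpace {ι : Type*} [Fintype ι]
    (K : AbstractSimplicialComplex ι) : TopologicalSpace (geometricRealization K) :=
  inferInstanceAs (TopologicalSpace
    {x : ι → ℝ // x ∈ stdSimplex ℝ ι ∧ ∃ s ∈ K.faces, Function.support x ⊆ (s : Set ι)})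

/-- The poset `S_p(G)` of nontrivial `p`-subgroups of `G`, ordered by inclusion. -/
abbrev PSubgroups (p : ℕ) (G : Type*) [Group G] : Type _ :=
  {P : Subgroup G // IsPGroup p P ∧ P ≠ ⊥}

noncomputable instance PSubgroups.instFintype (p : ℕ) (G : Type*) [Group G] [Finite G] :
    Fintype (PSubgroups p G) :=
  Fintype.ofFinite _

/-- `G` acts on `S_p(G)` by conjugation, `g • P = g P g⁻¹`. -/
instance PSubgroups.instMulAction (p : ℕ) (G : Type*) [Group G] :
    MulAction G (PSubgroups p G) where
  smul g P := ⟨MulAut.conj g • P.1, P.2.1.of_equiv (Subgroup.equivSMul (MulAut.conj g) P.1),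
    fun h => P.2.2 (by
      have h' := congrArg (fun Q : Subgroup G => (MulAut.conj g)⁻¹ • Q) h
      simpa using h')⟩
  one_smul P := Subtype.ext (by
    change MulAut.conj (1 : G) • P.1 = P.1
    rw [map_one, one_smul])
  mul_smul g h P := Subtype.ext (by
    change MulAut.conj (g * h) • P.1 = MulAut.conj g • MulAut.conj h • P.1
    rw [map_mul, mul_smul])

/-- Conjugation preserves inclusions. -/
theorem PSubgroups.smul_le_smul {p : ℕ} {G : Type*} [Group G] (g : G) {P Q : PSubgroups p G}
    (h : P ≤ Q) : g • P ≤ g • Q :=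
  Subgroup.pointwise_smul_le_pointwise_smul_iff.mpr h

/-- The `p`-subgroup complex `|S_p(G)|`: the geometric realization of the order complex of the poset
of nontrivial `p`-subgroups of the finite group `G`. -/
abbrev PSubgroupComplex (p : ℕ) (G : Type*) [Group G] [Finite G] : Type _ :=
  geometricRealization (orderComplex (PSubgroups p G))

/-- The action of `G` on `|S_p(G)|` induced by conjugation: the element `g` is affine on each
simplex and carries the vertex `P` to the vertex `g P g⁻¹`. In barycentric coordinates this reads
`(g • x) P = x (g⁻¹ • P)`. -/
instance PSubgroupComplex.instMulAction (p : ℕ) (G : Type*) [Group G] [Finite G] :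
    MulAction G (PSubgroupComplex p G) where
  smul g x := ⟨fun P => x.1 (g⁻¹ • P),
    ⟨fun P => x.2.1.1 _,
      (Equiv.sum_comp (MulAction.toPerm g⁻¹) x.1).trans x.2.1.2⟩, by
    classical
    obtain ⟨s, hs, hxs⟩ := x.2.2
    refine ⟨s.image (g • ·), ⟨hs.1.image _, ?_⟩, fun P hP => ?_⟩
    · rw [Finset.coe_image]
      rintro _ ⟨P, hP, rfl⟩ _ ⟨Q, hQ, rfl⟩ -
      exact (hs.2.total hP hQ).imp (PSubgroups.smul_le_smul g) (PSubgroups.smul_le_smul g)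
    · rw [Finset.coe_image]
      exact ⟨g⁻¹ • P, hxs hP, smul_inv_smul g P⟩⟩
  one_smul x := Subtype.ext (funext fun P => by
    change x.1 ((1 : G)⁻¹ • P) = x.1 P
    rw [inv_one, one_smul])
  mul_smul g h x := Subtype.ext (funext fun P => by
    change x.1 ((g * h)⁻¹ • P) = x.1 (h⁻¹ • g⁻¹ • P)
    rw [mul_inv_rev, mul_smul])

/-!
Call a `p`-subgroup `T` insertable into a chain `s` if it is comparable with all members of `s` and
normalizes those below it. The maximal insertable subgroups are Sylow subgroups of one subgroup
of `G` that fixes `s`, so they are conjugate by elements fixing `s`. Since normalizers grow in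
`p`-groups, a maximal insertable `T` stays so when it is inserted into `s` or removed from it.
Toggling `T` is therefore a `G`-equivariant acyclic matching on the chains, the empty one included,
which is unique only up to stabilizers. It collapses the order complex equivariantly onto the
vertices matched with the empty chain, the Sylow `p`-subgroups, which form a single orbit. Because
an element of `G` carrying a member of a chain to a member of the same chain fixes it, the orbit map
is injective on closed simplices, and each equivariant collapse is a deformation retraction of
orbit spaces.
-/

open scoped unitInterval

section Attaching

variable {A B D : Type*} [TopologicalSpace A] [TopologicalSpace B] [TopologicalSpace D]

theorem contractibleSpace_of_id_homotopic_comp {i : C(A, B)} {r : C(B, A)}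
    (h : (ContinuousMap.id B).Homotopic (i.comp r)) [ContractibleSpace A] :
    ContractibleSpace B := by
  rw [contractible_iff_id_nullhomotopic]
  obtain ⟨b, hb⟩ := ((id_nullhomotopic A).comp_right i).comp_left r
  exact ⟨b, h.trans hb⟩

variable [CompactSpace A] [CompactSpace D] [T2Space B] {i : C(A, B)} {f : C(D, B)}

-- A surjection from a compact space onto a Hausdorff one is a quotient map, so a homotopy on `B`
-- can be glued from one on `A` and one on `D`.
theorem exists_homotopy_extending_of_attach (hcover : Set.range i ∪ Set.range f = Set.univ)
    (hinj : Set.InjOn f (f ⁻¹' Set.range i)ᶜ) (F : C(I × D, D))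
    (hF : ∀ t, ∀ x ∈ f ⁻¹' Set.range i, F (t, x) = x) :
    ∃ Φ : C(I × B, B), (∀ t a, Φ (t, i a) = i a) ∧ ∀ t x, Φ (t, f x) = f (F (t, x)) := by
  let q : C((I × A) ⊕ (I × D), I × B) :=
    ⟨Sum.elim (Prod.map id i) (Prod.map id f), by fun_prop⟩
  let φ : C((I × A) ⊕ (I × D), B) :=
    ⟨Sum.elim (fun z => i z.2) (fun z => f (F z)), by fun_prop⟩
  have q_surjective : Function.Surjective q := by
    rintro ⟨t, b⟩
    rcases hcover.symm ▸ Set.mem_univ b with ⟨a, rfl⟩ | ⟨x, rfl⟩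
    exacts [⟨.inl (t, a), rfl⟩, ⟨.inr (t, x), rfl⟩]
  have glue : ∀ t a x, i a = f x → i a = f (F (t, x)) := fun t a x h => by
    rw [hF t x ⟨a, h⟩, h]
  have φ_factors : Function.FactorsThrough φ q := by
    rintro (⟨t, a⟩ | ⟨t, x⟩) (⟨u, b⟩ | ⟨u, y⟩) h <;> obtain ⟨rfl : t = u, h⟩ := Prod.ext_iff.1 h
    · exact h
    · exact glue t a y h
    · exact (glue t b x h.symm).symm
    · change f x = f y at h
      change f (F (t, x)) = f (F (t, y))
      by_cases hx : x ∈ f ⁻¹' Set.range i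
      · have hy : y ∈ f ⁻¹' Set.range i := by rwa [Set.mem_preimage, ← h]
        rw [hF t x hx, hF t y hy, h]
      · have hy : y ∉ f ⁻¹' Set.range i := by rwa [Set.mem_preimage, ← h]
        rw [hinj hx hy h]
  have hq := Topology.IsQuotientMap.of_surjective_continuous q_surjective q.continuous
  have hΦ : ∀ z, hq.lift φ φ_factors (q z) = φ z := DFunLike.congr_fun (hq.lift_comp φ φ_factors)
  exact ⟨hq.lift φ φ_factors, fun t a => hΦ (.inl (t, a)), fun t x => hΦ (.inr (t, x))⟩

theorem contractibleSpace_of_attach (hi : Function.Injective i)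
    (hcover : Set.range i ∪ Set.range f = Set.univ)
    (hinj : Set.InjOn f (f ⁻¹' Set.range i)ᶜ) {ρ : C(D, D)} (hρ : ∀ x, f (ρ x) ∈ Set.range i)
    (F : (ContinuousMap.id D).HomotopyRel ρ (f ⁻¹' Set.range i)) [ContractibleSpace A] :
    ContractibleSpace B := by
  obtain ⟨Φ, hΦi, hΦf⟩ := exists_homotopy_extending_of_attach hcover hinj F.toContinuousMap
    fun t x hx => F.eq_fst t hx
  have hΦ0 (b : B) : Φ (0, b) = b := by
    rcases hcover.symm ▸ Set.mem_univ b with ⟨a, rfl⟩ | ⟨x, rfl⟩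
    · exact hΦi 0 a
    · exact (hΦf 0 x).trans (congrArg f (F.apply_zero x))
  have hΦ1 (b : B) : Φ (1, b) ∈ Set.range i := by
    rcases hcover.symm ▸ Set.mem_univ b with ⟨a, rfl⟩ | ⟨x, rfl⟩
    · exact ⟨a, (hΦi 1 a).symm⟩
    · exact (hΦf 1 x).trans (congrArg f (F.apply_one x)) ▸ hρ x
  let e := (i.continuous.isClosedEmbedding hi).isEmbedding.toHomeomorph
  let r : C(B, A) := ⟨fun b => e.symm ⟨Φ (1, b), hΦ1 b⟩, by fun_prop⟩
  have ir_apply (b : B) : i (r b) = Φ (1, b) :=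
    congrArg Subtype.val (e.apply_symm_apply ⟨Φ (1, b), hΦ1 b⟩)
  exact contractibleSpace_of_id_homotopic_comp (i := i) (r := r)
    ⟨{ toContinuousMap := Φ
       map_zero_left := hΦ0
       map_one_left := fun b => (ir_apply b).symm }⟩

end Attaching

namespace geometricRealization

variable {V : Type*}

section HornDirection

variable [DecidableEq V] {s : Finset V} {v : V}

/-- The direction from the barycenter of the facet `s` of `insert v s` towards `v`, scaled so that
every coordinate on `s` decreases at unit speed. -/
noncomputable def hornDirection (s : Finset V) (v : V) : V → ℝ :=
  fun w => (if w = v then (s.card : ℝ) else 0) - if w ∈ s then 1 else 0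

theorem sum_hornDirection [Fintype V] : ∑ w, hornDirection s v w = 0 := by
  simp [hornDirection]

theorem hornDirection_of_mem (hv : v ∉ s) {w : V} (hw : w ∈ s) : hornDirection s v w = -1 := by
  simp [hornDirection, hw, ne_of_mem_of_not_mem hw hv]

theorem hornDirection_nonneg {w : V} (hw : w ∉ s) : 0 ≤ hornDirection s v w := by
  simp only [hornDirection, hw, if_false, sub_zero]
  positivity

theorem hornDirection_of_notMem {w : V} (hw : w ∉ insert v s) : hornDirection s v w = 0 := by
  obtain ⟨hwv, hws⟩ := not_or.1 (Finset.mem_insert.not.1 hw)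
  simp [hornDirection, hwv, hws]

theorem add_smul_hornDirection_nonneg (hv : v ∉ s) {x : V → ℝ} (hx : ∀ w, 0 ≤ x w) {c : ℝ}
    (hc : 0 ≤ c) (hcs : ∀ w ∈ s, c ≤ x w) (w : V) : 0 ≤ x w + c * hornDirection s v w := by
  by_cases hw : w ∈ s
  · rw [hornDirection_of_mem hv hw]
    linarith [hcs w hw]
  · exact add_nonneg (hx w) (mul_nonneg hc (hornDirection_nonneg hw))

end HornDirection

variable [Fintype V] {K : AbstractSimplicialComplex V}

theorem continuous_coord (v : V) : Continuous fun x : geometricRealization K => x.1 v :=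
  (continuous_apply v).comp continuous_subtype_val

instance : T2Space (geometricRealization K) :=
  inferInstanceAs (T2Space {_x : V → ℝ // _})

instance : CompactSpace (geometricRealization K) := by
  have support_subset_closed (s : Finset V) :
      IsClosed {x : V → ℝ | Function.support x ⊆ (s : Set V)} := by
    simp only [Function.support_subset_iff', Set.ofPred_forall]
    exact isClosed_biInter fun v _ => isClosed_eq (continuous_apply v) continuous_const
  have faces_closed :
      IsClosed {x : V → ℝ | ∃ s ∈ K.faces, Function.support x ⊆ (s : Set V)} := by
    convert K.faces.toFinite.isClosed_biUnion fun s _ => support_subset_closed s using 1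
    ext x
    simp
  exact isCompact_iff_compactSpace.mp ((isCompact_stdSimplex ℝ V).inter_right faces_closed)

/-- The carrier of `x`: the vertices of the smallest face of `K` whose simplex contains `x`. -/
noncomputable def supp (x : geometricRealization K) : Finset V :=
  Finset.univ.filter fun v => x.1 v ≠ 0

theorem mem_supp {x : geometricRealization K} {v : V} : v ∈ supp x ↔ x.1 v ≠ 0 := by
  simp [supp]

theorem notMem_supp {x : geometricRealization K} {v : V} : v ∉ supp x ↔ x.1 v = 0 := by
  simp [supp]

theorem supp_subset_iff {x : geometricRealization K} {s : Finset V} :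
    supp x ⊆ s ↔ ∀ v ∉ s, x.1 v = 0 :=
  forall_congr' fun _ => by rw [← notMem_supp, not_imp_not]

theorem supp_nonempty (x : geometricRealization K) : (supp x).Nonempty := by
  obtain ⟨v, -, hv⟩ := Finset.exists_ne_zero_of_sum_ne_zero (x.2.1.2.trans_ne one_ne_zero)
  exact ⟨v, mem_supp.2 hv⟩

theorem supp_mem_faces (x : geometricRealization K) : supp x ∈ K.faces := by
  obtain ⟨s, hs, hxs⟩ := x.2.2
  exact (K.isRelLowerSet_faces hs).2 (fun v hv => hxs (mem_supp.1 hv)) (supp_nonempty x)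

theorem eq_of_supp_eq_singleton {x y : geometricRealization K} {v : V} (hx : supp x = {v})
    (hy : supp y = {v}) : x = y := by
  classical
  have coord_eq_single : ∀ z : geometricRealization K, supp z = {v} → z.1 = Pi.single v 1 := by
    intro z hz
    have eq_zero : ∀ w, w ≠ v → z.1 w = 0 := fun w hw => notMem_supp.1 (by simpa [hz] using hw)
    have eq_one : z.1 v = 1 :=
      (Fintype.sum_eq_single v eq_zero).symm.trans z.2.1.2
    ext w
    rcases eq_or_ne w v with rfl | hw
    · rw [eq_one, Pi.single_eq_same]
    · rw [eq_zero w hw, Pi.single_eq_of_ne hw]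
  exact Subtype.ext ((coord_eq_single x hx).trans (coord_eq_single y hy).symm)

theorem exists_supp_eq_singleton (v : V) : ∃ x : geometricRealization K, supp x = {v} := by
  classical
  let x : geometricRealization K := ⟨Pi.single v 1, single_mem_stdSimplex ℝ v, {v},
    K.singleton_mem v, by rw [Finset.coe_singleton]; exact Pi.support_single_subset⟩
  have x_apply : ∀ w, x.1 w = (Pi.single v 1 : V → ℝ) w := fun _ => rfl
  exact ⟨x, by ext w; simp [mem_supp, x_apply, Pi.single_apply]⟩

/-- The closed simplex of `|K|` spanned by `s`. -/
def simplex (K : AbstractSimplicialComplex V) (s : Finset V) : Set (geometricRealization K) :=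
  {x | supp x ⊆ s}

theorem isClosed_simplex (s : Finset V) : IsClosed (simplex K s) := by
  simp only [simplex, supp_subset_iff, Set.ofPred_forall]
  exact isClosed_biInter fun v _ => isClosed_eq (continuous_coord v) continuous_const

instance (s : Finset V) : CompactSpace (simplex K s) :=
  isCompact_iff_compactSpace.mp (isClosed_simplex s).isCompact

section Horn

variable [DecidableEq V] {s : Finset V} {v : V}

/-- The point of the simplex `insert v s` reached from `x` by decreasing its coordinates on `s`
by `c` and moving their mass to `v`. -/
noncomputable def pushToHorn (hvs : insert v s ∈ K.faces) (hv : v ∉ s) (x : simplex K (insert v s))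
    (c : ℝ) (hc : 0 ≤ c) (hcs : ∀ w ∈ s, c ≤ x.1.1 w) : simplex K (insert v s) :=
  have coord_eq_zero : ∀ w ∉ insert v s, x.1.1 w + c * hornDirection s v w = 0 := fun w hw => by
    rw [supp_subset_iff.1 x.2 w hw, hornDirection_of_notMem hw, mul_zero, add_zero]
  ⟨⟨fun w => x.1.1 w + c * hornDirection s v w,
    ⟨add_smul_hornDirection_nonneg hv x.1.2.1.1 hc hcs, by
      rw [Finset.sum_add_distrib, ← Finset.mul_sum, sum_hornDirection, mul_zero, add_zero,
        x.1.2.1.2]⟩,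
    insert v s, hvs, Function.support_subset_iff'.2 coord_eq_zero⟩,
    supp_subset_iff.2 coord_eq_zero⟩

theorem pushToHorn_apply (hvs : insert v s ∈ K.faces) (hv : v ∉ s) (x : simplex K (insert v s))
    {c : ℝ} (hc : 0 ≤ c) (hcs : ∀ w ∈ s, c ≤ x.1.1 w) (w : V) :
    (pushToHorn hvs hv x c hc hcs).1.1 w = x.1.1 w + c * hornDirection s v w :=
  rfl

theorem pushToHorn_of_eq_zero (hvs : insert v s ∈ K.faces) (hv : v ∉ s)
    (x : simplex K (insert v s)) {c : ℝ} (hc : 0 ≤ c) (hcs : ∀ w ∈ s, c ≤ x.1.1 w) (h : c = 0) :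
    pushToHorn hvs hv x c hc hcs = x := by
  refine Subtype.ext (Subtype.ext (funext fun w => ?_))
  rw [pushToHorn_apply, h, zero_mul, add_zero]

theorem exists_homotopyRel_horn (hs : s.Nonempty) (hvs : insert v s ∈ K.faces) (hv : v ∉ s) :
    ∃ ρ : C(simplex K (insert v s), simplex K (insert v s)), (∀ x, ¬ s ⊆ supp (ρ x).1) ∧
      (ContinuousMap.id _).HomotopicRel ρ {x | ¬ s ⊆ supp x.1} := by
  let m (x : simplex K (insert v s)) : ℝ := s.inf' hs x.1.1
  have m_continuous : Continuous m := Continuous.finset_inf'_apply hs fun w _ =>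
    (continuous_coord w).comp continuous_subtype_val
  have m_nonneg (x) : 0 ≤ m x := Finset.le_inf' _ _ fun w _ => x.1.2.1.1 w
  have m_le (x) : ∀ w ∈ s, m x ≤ x.1.1 w := fun w hw => Finset.inf'_le _ hw
  have m_eq_zero {x} (hx : ¬ s ⊆ supp x.1) : m x = 0 := by
    obtain ⟨w, hw, hxw⟩ := Finset.not_subset.1 hx
    exact le_antisymm ((m_le x w hw).trans (notMem_supp.1 hxw).le) (m_nonneg x)
  let h (z : I × simplex K (insert v s)) : simplex K (insert v s) :=
    pushToHorn hvs hv z.2 (z.1 * m z.2) (mul_nonneg z.1.2.1 (m_nonneg _)) fun w hw =>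
      (mul_le_of_le_one_left (m_nonneg _) z.1.2.2).trans (m_le _ w hw)
  have h_continuous : Continuous h := by
    refine Continuous.subtype_mk (Continuous.subtype_mk (continuous_pi fun w => ?_) _) _
    have := (continuous_coord (K := K) w).comp (continuous_subtype_val.comp
      (continuous_snd (X := I) (Y := simplex K (insert v s))))
    fun_prop
  have h_eq {z} (hz : z.1 * m z.2 = 0) : h z = z.2 := pushToHorn_of_eq_zero hvs hv z.2 _ _ hz
  refine ⟨⟨fun x => h (1, x), by fun_prop⟩, fun x => ?_, ⟨⟨⟨h, h_continuous⟩, fun x => ?_,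
    fun x => rfl⟩, fun t x hx => ?_⟩⟩
  · obtain ⟨w, hw, hmw⟩ := s.exists_mem_eq_inf' hs x.1.1
    refine Finset.not_subset.2 ⟨w, hw, notMem_supp.2 ?_⟩
    simp [h, pushToHorn_apply, hornDirection_of_mem hv hw, m, hmw]
  · exact h_eq (by simp)
  · exact h_eq (by simp [m_eq_zero hx])

end Horn

end geometricRealization

section EquivariantCollapse

variable {G V : Type*} [Group G] [MulAction G V] [DecidableEq V]

/-- A simplicial action of `G` on `K` which never moves a vertex of a simplex to another vertex of
the same simplex. The orbit map then embeds every closed simplex of `|K|` into `|K|/G`. -/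
class IsRegularAction (G : Type*) {V : Type*} [Group G] [MulAction G V] [DecidableEq V]
    (K : AbstractSimplicialComplex V) : Prop where
  smul_mem_faces (g : G) {s : Finset V} : s ∈ K.faces → g • s ∈ K.faces
  smul_eq_of_mem {g : G} {s : Finset V} {v : V} : s ∈ K.faces → v ∈ s → g • v ∈ s → g • v = v

theorem IsRegularAction.smul_eq_of_subset {K : AbstractSimplicialComplex V} [IsRegularAction G K]
    {g : G} {s t : Finset V} (hs : s ∈ K.faces) (ht : t ⊆ s) (hgt : g • t ⊆ s) {v : V}
    (hv : v ∈ t) : g • v = v :=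
  smul_eq_of_mem hs (ht hv) (hgt (Finset.smul_mem_smul_finset hv))

theorem smul_finset_eq_of_forall {g : G} {s : Finset V} (h : ∀ v ∈ s, g • v = v) : g • s = s :=
  (Finset.image_congr h).trans Finset.image_id

/-- A `G`-invariant subcomplex `L` of `K`, given by its set of simplices. Unlike `K.faces`, the set
`L` is allowed to contain the empty simplex. -/
structure IsInvariantSubcomplex (G : Type*) {V : Type*} [Group G] [MulAction G V] [DecidableEq V]
    (K : AbstractSimplicialComplex V) (L : Set (Finset V)) : Prop where
  mem_faces {s : Finset V} : s ∈ L → s.Nonempty → s ∈ K.faces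
  isLowerSet : IsLowerSet L
  smul_mem (g : G) {s : Finset V} : s ∈ L → g • s ∈ L

/-- The simplex `s` is a free facet of `insert v s` in `L` up to its stabilizer: every simplex of
`L` properly containing `s` is a translate of `insert v s` by an element of `G` preserving `s`. -/
structure IsFreePair (G : Type*) {V : Type*} [Group G] [MulAction G V] [DecidableEq V]
    (L : Set (Finset V)) (s : Finset V) (v : V) : Prop where
  nonempty : s.Nonempty
  notMem : v ∉ s
  insert_mem : insert v s ∈ L
  exists_eq_smul_insert {t : Finset V} : t ∈ L → s ⊂ t → ∃ g : G, g • s = s ∧ t = g • insert v s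

/-- The `G`-equivariant elementary collapse of `L` which removes the orbits of `s` and of
`insert v s`. -/
def collapse (G : Type*) {V : Type*} [Group G] [MulAction G V] [DecidableEq V]
    (L : Set (Finset V)) (s : Finset V) (v : V) : Set (Finset V) :=
  L \ (MulAction.orbit G s ∪ MulAction.orbit G (insert v s))

variable {K : AbstractSimplicialComplex V} {L : Set (Finset V)} {s t : Finset V} {v : V}

theorem collapse_ssubset (h : IsFreePair G L s v) : collapse G L s v ⊂ L :=
  ⟨Set.sdiff_subset, fun hL => (hL h.insert_mem).2 (.inr (MulAction.mem_orbit_self _))⟩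

theorem IsInvariantSubcomplex.collapse (hL : IsInvariantSubcomplex G K L)
    (h : IsFreePair G L s v) : IsInvariantSubcomplex G K (collapse G L s v) where
  mem_faces hs := hL.mem_faces hs.1
  isLowerSet t u hut ht := by
    refine ⟨hL.isLowerSet hut ht.1, fun hu => ht.2 ?_⟩
    obtain ⟨g, hgu⟩ : ∃ g : G, g • s ⊆ u := by
      rcases hu with ⟨g, rfl⟩ | ⟨g, rfl⟩
      exacts [⟨g, subset_rfl⟩, ⟨g, Finset.smul_finset_subset_smul_finset (s.subset_insert v)⟩]
    have hst : s ⊆ g⁻¹ • t := Finset.subset_smul_finset_iff.2 (by simpa using hgu.trans hut)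
    rcases hst.eq_or_ssubset with hst | hst
    · exact .inl ⟨g, by simp only [hst, smul_inv_smul]⟩
    · obtain ⟨k, -, hk⟩ := h.exists_eq_smul_insert (hL.smul_mem g⁻¹ ht.1) hst
      exact .inr ⟨g * k, by simp only [mul_smul, ← hk, smul_inv_smul]⟩
  smul_mem g t ht := ⟨hL.smul_mem g ht.1, by
    simpa only [Set.mem_union, ← MulAction.orbit_eq_iff, MulAction.orbit_smul] using ht.2⟩

theorem mem_collapse_iff_of_subset_insert [IsRegularAction G K] (hL : IsInvariantSubcomplex G K L)
    (h : IsFreePair G L s v) (ht : t ⊆ insert v s) : t ∈ collapse G L s v ↔ ¬ s ⊆ t := by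
  have hvs : insert v s ∈ K.faces := hL.mem_faces h.insert_mem (Finset.insert_nonempty v s)
  have eq_of_mem_orbit {u} (hu : u ⊆ insert v s) : t ∈ MulAction.orbit G u → t = u := by
    rintro ⟨g, rfl⟩
    exact smul_finset_eq_of_forall fun w => IsRegularAction.smul_eq_of_subset hvs hu ht
  constructor
  · intro htc hst
    rcases (Finset.wcovBy_insert s v).eq_or_eq hst ht with rfl | rfl
    · exact htc.2 (.inl (MulAction.mem_orbit_self _))
    · exact htc.2 (.inr (MulAction.mem_orbit_self _))
  · refine fun hst => ⟨hL.isLowerSet ht h.insert_mem, ?_⟩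
    rintro (hts | hts)
    · exact hst (eq_of_mem_orbit (s.subset_insert v) hts).ge
    · exact hst ((s.subset_insert v).trans (eq_of_mem_orbit subset_rfl hts).ge)

end EquivariantCollapse

section EquivariantMatching

variable {G V : Type*} [Group G] [MulAction G V] [DecidableEq V] {K : AbstractSimplicialComplex V}

/-- An acyclic `G`-equivariant matching, in the sense of discrete Morse theory, on the simplices of
`K` together with the empty one. The relation `Rel s v` says that `s` is matched with `insert v s`;
such a `v` is unique only up to the stabilizer of `s`. Every simplex is matched, and acyclicity is
witnessed by the function `level`. -/
structure EquivariantMatching (G : Type*) {V : Type*} [Group G] [MulAction G V] [DecidableEq V]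
    (K : AbstractSimplicialComplex V) where
  Rel : Finset V → V → Prop
  level : Finset V → ℕ
  insert_mem_faces {s : Finset V} {v : V} : Rel s v → insert v s ∈ K.faces
  notMem {s : Finset V} {v : V} : Rel s v → v ∉ s
  smul (g : G) {s : Finset V} {v : V} : Rel s v → Rel (g • s) (g • v)
  exists_smul_eq {s : Finset V} {v w : V} : Rel s v → Rel s w → ∃ g : G, g • s = s ∧ g • v = w
  not_rel_insert {s : Finset V} {v w : V} : Rel s v → ¬ Rel (insert v s) w
  level_lt {s t : Finset V} {v : V} : Rel s v → t ⊆ insert v s → v ∈ t → level s < level t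
  exists_rel_empty : ∃ v, Rel ∅ v
  exists_rel_or_rel_erase {s : Finset V} :
    s ∈ K.faces → (∃ v, Rel s v) ∨ ∃ v ∈ s, Rel (s.erase v) v

namespace EquivariantMatching

/-- An invariant subcomplex of `K`, containing the empty simplex, on which `m` restricts to a
matching. -/
structure RestrictsTo (m : EquivariantMatching G K) (L : Set (Finset V)) : Prop
    extends IsInvariantSubcomplex G K L where
  empty_mem : ∅ ∈ L
  insert_mem {s : Finset V} {v : V} : s ∈ L → m.Rel s v → insert v s ∈ L

variable {m : EquivariantMatching G K} {L : Set (Finset V)} {s t : Finset V} {v w : V}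

theorem eq_of_insert_eq (hv : m.Rel s v) (hw : m.Rel t w) (h : insert v s = insert w t) :
    s = t := by
  rcases eq_or_ne v w with rfl | hvw
  · rw [← Finset.erase_insert (m.notMem hv), h, Finset.erase_insert (m.notMem hw)]
  · have hvt : v ∈ t := Finset.mem_of_mem_insert_of_ne (h ▸ s.mem_insert_self v) hvw
    have hws : w ∈ s := Finset.mem_of_mem_insert_of_ne (h.symm ▸ t.mem_insert_self w) hvw.symm
    exact absurd (m.level_lt hv ((t.subset_insert w).trans h.ge) hvt)
      (m.level_lt hw ((s.subset_insert v).trans h.le) hws).not_gt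

theorem RestrictsTo.collapse (hL : m.RestrictsTo L) (hv : m.Rel s v) (h : IsFreePair G L s v) :
    m.RestrictsTo (collapse G L s v) where
  toIsInvariantSubcomplex := hL.toIsInvariantSubcomplex.collapse h
  empty_mem := by
    refine ⟨hL.empty_mem, ?_⟩
    rintro (⟨g, hg⟩ | ⟨g, hg⟩)
    · exact h.nonempty.ne_empty (Finset.smul_finset_eq_empty.1 hg)
    · exact Finset.insert_ne_empty v s (Finset.smul_finset_eq_empty.1 hg)
  insert_mem {t w} ht hw := by
    refine ⟨hL.insert_mem ht.1 hw, ?_⟩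
    rintro (⟨g, hg : g • s = _⟩ | ⟨g, hg⟩)
    · exact m.not_rel_insert hw (hg ▸ m.smul g hv)
    · exact ht.2 (.inl ⟨g, eq_of_insert_eq (m.smul g hv) hw
        ((Finset.smul_finset_insert g v s).symm.trans hg)⟩)

theorem RestrictsTo.exists_rel_erase_of_forall_not_rel (hL : m.RestrictsTo L) (hs : s ∈ L)
    (hs' : s.Nonempty) (h : ∀ v, ¬ m.Rel s v) : ∃ v ∈ s, m.Rel (s.erase v) v :=
  (m.exists_rel_or_rel_erase (hL.mem_faces hs hs')).resolve_left fun ⟨v, hv⟩ => h v hv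

theorem RestrictsTo.exists_eq_singleton (hL : m.RestrictsTo L)
    (h : ∀ s ∈ L, s.Nonempty → ∀ v, ¬ m.Rel s v) (hs : s ∈ L) (hs' : s.Nonempty) :
    ∃ v, s = {v} ∧ m.Rel ∅ v := by
  obtain ⟨v, hvs, hv⟩ := hL.exists_rel_erase_of_forall_not_rel hs hs' (h s hs hs')
  have erase_eq : s.erase v = ∅ := Finset.not_nonempty_iff_eq_empty.1 fun hne =>
    h _ (hL.isLowerSet (s.erase_subset v) hs) hne v hv
  exact ⟨v, by rw [← Finset.insert_erase hvs, erase_eq, insert_empty_eq], erase_eq ▸ hv⟩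

theorem restrictsTo_insert_empty_faces [IsRegularAction G K] (m : EquivariantMatching G K) :
    m.RestrictsTo (insert ∅ K.faces) where
  mem_faces hs hs' := hs.resolve_left hs'.ne_empty
  isLowerSet := by
    rintro s t hts (rfl | hs)
    · exact .inl (Finset.subset_empty.1 hts)
    · exact t.eq_empty_or_nonempty.imp id ((K.isRelLowerSet_faces hs).2 hts)
  smul_mem g s := Or.imp Finset.smul_finset_eq_empty.2 (IsRegularAction.smul_mem_faces g)
  empty_mem := Set.mem_insert ∅ K.faces
  insert_mem _ hv := .inr (m.insert_mem_faces hv)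

-- Among the matched simplices of maximal dimension, one of minimal level is free.
theorem RestrictsTo.exists_isFreePair [Finite V] (hL : m.RestrictsTo L)
    (h : ∃ s ∈ L, s.Nonempty ∧ ∃ v, m.Rel s v) : ∃ s v, m.Rel s v ∧ IsFreePair G L s v := by
  let M : Set (Finset V) := {s | s ∈ L ∧ s.Nonempty ∧ ∃ v, m.Rel s v}
  obtain ⟨s₀, hs₀, card_le⟩ := M.exists_max_image Finset.card M.toFinite h
  obtain ⟨s, ⟨⟨hsL, hs, v, hv⟩, hcard⟩, level_le⟩ :=
    (M ∩ {s | s.card = s₀.card}).exists_min_image m.level (Set.toFinite _) ⟨s₀, hs₀, rfl⟩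
  rw [← show s.card = s₀.card from hcard] at card_le level_le
  refine ⟨s, v, hv, hs, m.notMem hv, hL.insert_mem hsL hv, fun {t} htL hst => ?_⟩
  have ht : t.Nonempty := hs.mono hst.subset
  obtain ⟨w, hwt, hw⟩ := hL.exists_rel_erase_of_forall_not_rel htL ht fun w hw =>
    (Finset.card_lt_card hst).not_ge (card_le t ⟨htL, ht, w, hw⟩)
  have hcard_erase : (t.erase w).card + 1 = t.card := Finset.card_erase_add_one hwt
  have hlt : s.card < t.card := Finset.card_lt_card hst
  have herase : t.erase w ∈ M := ⟨hL.isLowerSet (t.erase_subset w) htL,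
    Finset.card_pos.1 (by have := hs.card_pos; omega), w, hw⟩
  have card_eq : (t.erase w).card = s.card := by have := card_le _ herase; omega
  have hws : w ∉ s := fun hws => (level_le _ ⟨herase, card_eq⟩).not_gt
    (m.level_lt hw ((Finset.insert_erase hwt).symm ▸ hst.subset) hws)
  obtain rfl : s = t.erase w :=
    Finset.eq_of_subset_of_card_le (Finset.subset_erase.2 ⟨hst.subset, hws⟩) card_eq.le
  obtain ⟨g, hgs, rfl⟩ := m.exists_smul_eq hv hw
  refine ⟨g, hgs, ?_⟩
  rw [Finset.smul_finset_insert, hgs, Finset.insert_erase hwt]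

end EquivariantMatching

end EquivariantMatching

section OrbitSpace

open geometricRealization

/-- The action of `G` on `|K|` is the affine extension of its action on the vertices. -/
class IsAffineAction (G : Type*) {V : Type*} [Group G] [MulAction G V] [Fintype V]
    (K : AbstractSimplicialComplex V) [MulAction G (geometricRealization K)] : Prop where
  smul_apply (g : G) (x : geometricRealization K) (v : V) : (g • x).1 v = x.1 (g⁻¹ • v)

variable {G V : Type*} [Group G] [Fintype V] {K : AbstractSimplicialComplex V}
  [MulAction G (geometricRealization K)]

variable (G K) in
/-- The quotient map `|K| → |K|/G`. -/
def orbitMap : C(geometricRealization K, MulAction.orbitRel.Quotient G (geometricRealization K)) :=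
  ⟨Quotient.mk _, continuous_quotient_mk'⟩

theorem orbitMap_surjective : Function.Surjective (orbitMap G K) :=
  Quotient.mk_surjective

theorem orbitMap_eq_iff {x y : geometricRealization K} :
    orbitMap G K x = orbitMap G K y ↔ ∃ g : G, g • y = x :=
  Quotient.eq

theorem orbitMap_smul (g : G) (x : geometricRealization K) :
    orbitMap G K (g • x) = orbitMap G K x :=
  orbitMap_eq_iff.2 ⟨g, rfl⟩

variable (G K) in
/-- The image in `|K|/G` of the subcomplex of `|K|` with set of simplices `L`. -/
def orbitImage (L : Set (Finset V)) :
    Set (MulAction.orbitRel.Quotient G (geometricRealization K)) :=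
  orbitMap G K '' {x | supp x ∈ L}

variable {L : Set (Finset V)}

theorem isCompact_orbitImage (hL : IsLowerSet L) : IsCompact (orbitImage G K L) := by
  have eq_iUnion : {x : geometricRealization K | supp x ∈ L} = ⋃ s ∈ L, simplex K s := by
    ext x
    rw [Set.mem_iUnion₂]
    exact ⟨fun hx => ⟨supp x, hx, Finset.Subset.refl _⟩, fun ⟨s, hs, hxs⟩ => hL hxs hs⟩
  refine IsCompact.image ?_ (orbitMap G K).continuous
  rw [eq_iUnion]
  exact L.toFinite.isCompact_biUnion fun s _ => (isClosed_simplex s).isCompact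

variable [MulAction G V] [IsAffineAction G K]

theorem smul_eq_of_forall_mem_supp {g : G} {x : geometricRealization K}
    (h : ∀ v ∈ supp x, g • v = v) : g • x = x := by
  refine Subtype.ext (funext fun v => ?_)
  rw [IsAffineAction.smul_apply]
  by_cases hv : v ∈ supp x ∨ g⁻¹ • v ∈ supp x
  · rw [hv.elim (fun hv => inv_smul_eq_iff.2 (h v hv).symm) fun hv => by simpa using (h _ hv).symm]
  · obtain ⟨hv, hgv⟩ := not_or.1 hv
    rw [notMem_supp.1 hv, notMem_supp.1 hgv]

instance continuousConstSMul_geometricRealization :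
    ContinuousConstSMul G (geometricRealization K) where
  continuous_const_smul g := Continuous.subtype_mk
    (continuous_pi fun v => (continuous_coord (g⁻¹ • v)).congr fun x =>
      (IsAffineAction.smul_apply g x v).symm) _

instance t2Space_orbitSpace [Finite G] :
    T2Space (MulAction.orbitRel.Quotient G (geometricRealization K)) :=
  t2Space_of_properlyDiscontinuousSMul_of_t2Space

variable [DecidableEq V]

theorem supp_smul (g : G) (x : geometricRealization K) : supp (g • x) = g • supp x := by
  ext v
  rw [mem_supp, IsAffineAction.smul_apply, ← mem_supp, Finset.inv_smul_mem_iff]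

theorem injOn_orbitMap_simplex [IsRegularAction G K] {s : Finset V} (hs : s ∈ K.faces) :
    Set.InjOn (orbitMap G K) (simplex K s) := by
  intro x hx y hy hxy
  obtain ⟨g, rfl⟩ := orbitMap_eq_iff.1 hxy
  exact smul_eq_of_forall_mem_supp fun v =>
    IsRegularAction.smul_eq_of_subset hs hy ((supp_smul g y).ge.trans hx)

theorem orbitMap_mem_orbitImage_iff (hL : IsInvariantSubcomplex G K L)
    {x : geometricRealization K} : orbitMap G K x ∈ orbitImage G K L ↔ supp x ∈ L := by
  refine ⟨?_, fun hx => ⟨x, hx, rfl⟩⟩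
  rintro ⟨y, hy, hyx⟩
  obtain ⟨g, rfl⟩ := orbitMap_eq_iff.1 hyx.symm
  exact supp_smul g y ▸ hL.smul_mem g hy

section Collapse

variable {s : Finset V} {v : V}

theorem orbitImage_eq_collapse_union (hL : IsInvariantSubcomplex G K L) (h : IsFreePair G L s v) :
    orbitImage G K L =
      orbitImage G K (collapse G L s v) ∪ orbitMap G K '' simplex K (insert v s) := by
  have mem_image_of_supp_eq {x : geometricRealization K} {t : Finset V} (ht : t ⊆ insert v s)
      {g : G} (hg : g • t = supp x) : orbitMap G K x ∈ orbitMap G K '' simplex K (insert v s) :=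
    ⟨g⁻¹ • x, by simpa [simplex, supp_smul, ← hg] using ht, orbitMap_smul _ _⟩
  refine subset_antisymm ?_ (Set.union_subset ?_ (Set.image_mono fun x hx => ?_))
  · rintro _ ⟨x, hx, rfl⟩
    by_cases hxc : supp x ∈ collapse G L s v
    · exact .inl ⟨x, hxc, rfl⟩
    · rcases not_not.1 fun hx' => hxc ⟨hx, hx'⟩ with ⟨g, hg⟩ | ⟨g, hg⟩
      exacts [.inr (mem_image_of_supp_eq (s.subset_insert v) hg),
        .inr (mem_image_of_supp_eq subset_rfl hg)]
  · exact Set.image_mono fun x hx => hx.1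
  · exact hL.isLowerSet hx h.insert_mem

theorem contractibleSpace_orbitImage_of_collapse [Finite G] [IsRegularAction G K]
    (hL : IsInvariantSubcomplex G K L) (h : IsFreePair G L s v)
    [ContractibleSpace (orbitImage G K (collapse G L s v))] :
    ContractibleSpace (orbitImage G K L) := by
  have hvs : insert v s ∈ K.faces := hL.mem_faces h.insert_mem (Finset.insert_nonempty v s)
  have hunion := orbitImage_eq_collapse_union hL h
  have := isCompact_iff_compactSpace.1
    (isCompact_orbitImage (G := G) (K := K) (hL.collapse h).isLowerSet)
  have hsubset : orbitImage G K (collapse G L s v) ⊆ orbitImage G K L :=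
    hunion ▸ Set.subset_union_left
  let i : C(orbitImage G K (collapse G L s v), orbitImage G K L) := .inclusion hsubset
  let f : C(simplex K (insert v s), orbitImage G K L) :=
    ⟨fun x => ⟨orbitMap G K x, hunion ▸ .inr ⟨x, x.2, rfl⟩⟩, by fun_prop⟩
  have mem_range_i (b) : b ∈ Set.range i ↔ b.1 ∈ orbitImage G K (collapse G L s v) :=
    ⟨by rintro ⟨a, rfl⟩; exact a.2, fun hb => ⟨⟨b.1, hb⟩, rfl⟩⟩
  have f_mem_range (x) : f x ∈ Set.range i ↔ ¬ s ⊆ supp x.1 := by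
    rw [mem_range_i, ← mem_collapse_iff_of_subset_insert hL h x.2]
    exact orbitMap_mem_orbitImage_iff (hL.collapse h)
  have hcover : Set.range i ∪ Set.range f = Set.univ := by
    refine Set.eq_univ_of_forall fun ⟨b, hb⟩ => ?_
    rcases hunion ▸ hb with hb' | ⟨x, hx, rfl⟩
    exacts [.inl ((mem_range_i _).2 hb'), .inr ⟨⟨x, hx⟩, rfl⟩]
  have hinj : Function.Injective f := fun x y hxy => Subtype.ext
    (injOn_orbitMap_simplex (G := G) hvs x.2 y.2 (congrArg Subtype.val hxy))
  obtain ⟨ρ, hρ, ⟨F⟩⟩ := exists_homotopyRel_horn h.nonempty hvs h.notMem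
  have hpre : f ⁻¹' Set.range i = {x | ¬ s ⊆ supp x.1} := Set.ext f_mem_range
  exact contractibleSpace_of_attach (Set.inclusion_injective hsubset) hcover hinj.injOn
    (fun x => (f_mem_range _).2 (hρ x)) (hpre ▸ F)

end Collapse

namespace EquivariantMatching

variable {m : EquivariantMatching G K}

theorem RestrictsTo.contractibleSpace_orbitImage_of_forall_not_rel (hL : m.RestrictsTo L)
    (h : ∀ s ∈ L, s.Nonempty → ∀ v, ¬ m.Rel s v) : ContractibleSpace (orbitImage G K L) := by
  have : Subsingleton (orbitImage G K L) := by
    rw [Set.subsingleton_coe]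
    rintro _ ⟨x, hx, rfl⟩ _ ⟨y, hy, rfl⟩
    obtain ⟨v, hxv, hv⟩ := hL.exists_eq_singleton h hx (supp_nonempty x)
    obtain ⟨w, hyw, hw⟩ := hL.exists_eq_singleton h hy (supp_nonempty y)
    obtain ⟨g, -, rfl⟩ := m.exists_smul_eq hw hv
    refine orbitMap_eq_iff.2 ⟨g, eq_of_supp_eq_singleton ?_ hxv⟩
    rw [supp_smul, hyw, Finset.smul_finset_singleton]
  obtain ⟨v, hv⟩ := m.exists_rel_empty
  obtain ⟨x, hx⟩ := exists_supp_eq_singleton (K := K) v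
  have : Nonempty (orbitImage G K L) :=
    ⟨orbitMap G K x, x, by simpa [hx] using hL.insert_mem hL.empty_mem hv, rfl⟩
  infer_instance

variable [Finite G] [IsRegularAction G K]

theorem RestrictsTo.contractibleSpace_orbitImage (hL : m.RestrictsTo L) :
    ContractibleSpace (orbitImage G K L) := by
  induction L using WellFoundedLT.induction with
  | ind L ih =>
    by_cases h : ∃ s ∈ L, s.Nonempty ∧ ∃ v, m.Rel s v
    · obtain ⟨s, v, hv, hfree⟩ := hL.exists_isFreePair h
      have := ih _ (collapse_ssubset hfree) (hL.collapse hv hfree)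
      exact contractibleSpace_orbitImage_of_collapse hL.toIsInvariantSubcomplex hfree
    · push Not at h
      exact hL.contractibleSpace_orbitImage_of_forall_not_rel h

theorem contractibleSpace_orbitSpace (m : EquivariantMatching G K) :
    ContractibleSpace (MulAction.orbitRel.Quotient G (geometricRealization K)) := by
  have orbitImage_eq_univ : orbitImage G K (insert ∅ K.faces) = Set.univ := by
    refine Set.eq_univ_of_forall fun b => ?_
    obtain ⟨x, rfl⟩ := orbitMap_surjective b
    exact ⟨x, .inr (supp_mem_faces x), rfl⟩
  have := m.restrictsTo_insert_empty_faces.contractibleSpace_orbitImage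
  exact (((Homeomorph.setCongr orbitImage_eq_univ).trans
    (Homeomorph.Set.univ _)).contractibleSpace_iff).1 this

end EquivariantMatching

end OrbitSpace

section OrderComplex

variable {G S : Type*} [Group G] [PartialOrder S] [DecidableEq S] [MulAction G S]
  [CovariantClass G S HSMul.hSMul LE.le]

theorem isChain_smul_finset (g : G) {s : Finset S} (hs : IsChain (· ≤ ·) (s : Set S)) :
    IsChain (· ≤ ·) ((g • s : Finset S) : Set S) := by
  rw [Finset.coe_smul_finset]
  exact hs.image_of_map_rel _ _ _ fun _ _ hab => smul_mono_right g hab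

instance isRegularAction_orderComplex [Finite G] : IsRegularAction G (orderComplex S) where
  smul_mem_faces g _ hs := ⟨hs.1.smul_finset, isChain_smul_finset g hs.2⟩
  smul_eq_of_mem hs ha hga :=
    (hs.2.total hga ha).elim smul_eq_of_smul_le smul_eq_of_le_smul

end OrderComplex

namespace PSubgroups

variable {p : ℕ} {G : Type*} [Group G]

instance : CovariantClass G (PSubgroups p G) HSMul.hSMul LE.le :=
  ⟨fun g _ _ => smul_le_smul g⟩

theorem coe_smul (g : G) (P : PSubgroups p G) : (g • P).1 = MulAut.conj g • P.1 :=
  rfl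

theorem le_stabilizer_self (P : PSubgroups p G) : P.1 ≤ MulAction.stabilizer G P :=
  fun _ hg => Subtype.ext (Subgroup.conj_smul_eq_self_of_mem hg)

theorem stabilizer_eq_normalizer (P : PSubgroups p G) :
    MulAction.stabilizer G P = Subgroup.normalizer (P.1 : Set G) := by
  ext g
  rw [Subgroup.mem_normalizer_iff_map_conj_eq]
  exact Subtype.ext_iff

theorem coe_smul_le_stabilizer_smul {P Q : PSubgroups p G} (g : G)
    (h : Q.1 ≤ MulAction.stabilizer G P) : (g • Q).1 ≤ MulAction.stabilizer G (g • P) := by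
  rw [MulAction.stabilizer_smul_eq_stabilizer_map_conj]
  exact Subgroup.map_mono h

theorem nonempty_of_dvd_card [Finite G] [Fact p.Prime] (h : p ∣ Nat.card G) :
    Nonempty (PSubgroups p G) := by
  obtain ⟨P⟩ : Nonempty (Sylow p G) := inferInstance
  exact ⟨P.1, P.2, P.ne_bot_of_dvd_card h⟩

-- Normalizers grow in `p`-groups.
theorem exists_lt_le_stabilizer [Finite G] [Fact p.Prime] {P Q : PSubgroups p G} (h : P < Q) :
    ∃ R : PSubgroups p G, P < R ∧ R ≤ Q ∧ R.1 ≤ MulAction.stabilizer G P := by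
  have : Group.IsNilpotent Q.1 := Q.2.1.isNilpotent
  have subgroupOf_lt_top : P.1.subgroupOf Q.1 < ⊤ :=
    lt_top_iff_ne_top.2 fun htop => h.not_ge (Subgroup.subgroupOf_eq_top.1 htop)
  have subgroupOf_lt := Group.normalizerCondition_of_isNilpotent _ subgroupOf_lt_top
  rw [← Subgroup.subgroupOf_normalizer_eq h.le, ← stabilizer_eq_normalizer] at subgroupOf_lt
  have hP : P.1 ≤ Q.1 ⊓ MulAction.stabilizer G P := le_inf h.le P.le_stabilizer_self
  exact ⟨⟨Q.1 ⊓ MulAction.stabilizer G P, Q.2.1.to_inf_left, ne_bot_of_le_ne_bot P.2.2 hP⟩,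
    lt_of_le_not_ge hP fun hle => subgroupOf_lt.not_ge fun x hx => hle ⟨x.2, hx⟩,
    fun _ hx => hx.1, fun _ hx => hx.2⟩

section Sylow

variable {H : Subgroup G}

theorem exists_sylow_map_subtype_eq {T : PSubgroups p G}
    (hT : Maximal (fun S : PSubgroups p G => S.1 ≤ H) T) :
    ∃ P : Sylow p H, P.1.map H.subtype = T.1 := by
  obtain ⟨P, hP⟩ := T.2.1.comap_subtype (K := H) |>.exists_le_sylow
  have hTP : T.1 ≤ P.1.map H.subtype := by
    rw [← Subgroup.map_subgroupOf_eq_of_le hT.1]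
    exact Subgroup.map_mono hP
  exact ⟨P, le_antisymm (hT.2 (y := ⟨_, P.2.map _, ne_bot_of_le_ne_bot T.2.2 hTP⟩)
    (Subgroup.map_subtype_le _) hTP) hTP⟩

theorem exists_smul_eq_of_maximal [Finite G] [Fact p.Prime] {T T' : PSubgroups p G}
    (hT : Maximal (fun S : PSubgroups p G => S.1 ≤ H) T)
    (hT' : Maximal (fun S : PSubgroups p G => S.1 ≤ H) T') : ∃ g ∈ H, g • T = T' := by
  obtain ⟨P, hP⟩ := exists_sylow_map_subtype_eq hT
  obtain ⟨P', hP'⟩ := exists_sylow_map_subtype_eq hT'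
  obtain ⟨h, rfl⟩ := MulAction.exists_smul_eq H P P'
  refine ⟨h, h.2, Subtype.ext ?_⟩
  rw [coe_smul, ← hP, ← hP', Sylow.coe_subgroup_smul]
  change (P.1.map H.subtype).map (MulAut.conj (h : G)).toMonoidHom =
    (P.1.map (MulAut.conj h).toMonoidHom).map H.subtype
  rw [Subgroup.map_map, Subgroup.map_map]
  rfl

end Sylow

/-- The subgroup `Q` fits into the chain `s`, and normalizes every member of `s` below it. -/
def IsInsertable (s : Finset (PSubgroups p G)) (Q : PSubgroups p G) : Prop :=
  ∀ P ∈ s, Q ≤ P ∨ P ≤ Q ∧ Q.1 ≤ MulAction.stabilizer G P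

/-- The largest subgroup which normalizes every member of `s` and is contained in the members of
`s` not below `T`. The maximal insertable subgroups are Sylow subgroups of such hulls. -/
def hull (s : Finset (PSubgroups p G)) (T : PSubgroups p G) : Subgroup G :=
  (⨅ P ∈ s, MulAction.stabilizer G P) ⊓ ⨅ P ∈ s, ⨅ _ : ¬ P ≤ T, P.1

variable {s t : Finset (PSubgroups p G)} {P Q T T' : PSubgroups p G}

theorem IsInsertable.mono (h : IsInsertable t Q) (hst : s ⊆ t) : IsInsertable s Q :=
  fun P hP => h P (hst hP)

theorem IsInsertable.le_total (h : IsInsertable s Q) (hP : P ∈ s) : P ≤ Q ∨ Q ≤ P :=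
  (h P hP).symm.imp_left And.left

theorem IsInsertable.le_stabilizer (h : IsInsertable s Q) (hP : P ∈ s) :
    Q.1 ≤ MulAction.stabilizer G P :=
  (h P hP).elim (fun hQP => le_trans hQP P.le_stabilizer_self) And.right

theorem IsInsertable.of_mem_of_le (h : IsInsertable s Q)
    (hs : IsChain (· ≤ ·) (s : Set (PSubgroups p G))) (hP : P ∈ s) (hPQ : P ≤ Q) :
    IsInsertable s P := fun _ hR =>
  (hs.total hP hR).imp_right fun hRP => ⟨hRP, le_trans hPQ (h.le_stabilizer hR)⟩

theorem le_hull_iff {H : Subgroup G} :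
    H ≤ hull s T ↔ ∀ P ∈ s, H ≤ MulAction.stabilizer G P ∧ (¬ P ≤ T → H ≤ P.1) := by
  simp only [hull, le_inf_iff, le_iInf_iff, forall_and]

theorem maximal_le_hull_of_maximal_isInsertable (hT : Maximal (IsInsertable s) T) :
    Maximal (fun S : PSubgroups p G => S.1 ≤ hull s T) T := by
  refine ⟨le_hull_iff.2 fun P hP =>
    ⟨hT.1.le_stabilizer hP, (hT.1.le_total hP).resolve_left⟩, fun S hS hTS => hT.2 ?_ hTS⟩
  intro P hP
  obtain ⟨hS_stab, hS_le⟩ := le_hull_iff.1 hS P hP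
  by_cases hPT : P ≤ T
  exacts [.inr ⟨hPT.trans hTS, hS_stab⟩, .inl (hS_le hPT)]

theorem le_of_le_of_maximal_isInsertable (hT : Maximal (IsInsertable s) T)
    (hT' : Maximal (IsInsertable s) T') (hP : P ∈ s) (hPT : P ≤ T) : P ≤ T' :=
  (hT'.1.le_total hP).elim id fun hT'P => hPT.trans (hT'.2 hT.1 (hT'P.trans hPT))

theorem exists_smul_eq_of_maximal_isInsertable [Finite G] [Fact p.Prime]
    (hT : Maximal (IsInsertable s) T) (hT' : Maximal (IsInsertable s) T') :
    ∃ g : G, (∀ P ∈ s, g • P = P) ∧ g • T = T' := by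
  have hull_eq : hull s T = hull s T' := by
    refine eq_of_forall_le_iff fun H => ?_
    rw [le_hull_iff, le_hull_iff]
    refine forall₂_congr fun P hP => ?_
    rw [show P ≤ T ↔ P ≤ T' from ⟨le_of_le_of_maximal_isInsertable hT hT' hP,
      le_of_le_of_maximal_isInsertable hT' hT hP⟩]
  obtain ⟨g, hg, hgT⟩ := exists_smul_eq_of_maximal (maximal_le_hull_of_maximal_isInsertable hT)
    (hull_eq ▸ maximal_le_hull_of_maximal_isInsertable hT')
  exact ⟨g, fun P hP => (le_hull_iff.1 le_rfl P hP).1 hg, hgT⟩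

theorem exists_maximal_isInsertable [Finite G] [Nonempty (PSubgroups p G)]
    (hs : IsChain (· ≤ ·) (s : Set (PSubgroups p G))) : ∃ T, Maximal (IsInsertable s) T := by
  refine Set.Finite.exists_maximal (Set.toFinite {Q | IsInsertable s Q}) ?_
  rcases s.eq_empty_or_nonempty with rfl | hne
  · obtain ⟨Q⟩ := ‹Nonempty (PSubgroups p G)›
    exact ⟨Q, fun P hP => absurd hP (Finset.notMem_empty P)⟩
  · obtain ⟨Q, hQ, hQmin⟩ := s.exists_minimal hne
    exact ⟨Q, fun P hP => .inl ((hs.total hQ hP).elim id (hQmin hP))⟩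

open scoped Classical in
/-- The order of the largest insertable member of `s`, or zero if there is none. -/
noncomputable def insertableOrder (s : Finset (PSubgroups p G)) : ℕ :=
  (s.filter (IsInsertable s)).sup fun Q => Nat.card Q.1

theorem insertableOrder_lt_card [Finite G] (hT : Maximal (IsInsertable s) T) (hTs : T ∉ s) :
    insertableOrder s < Nat.card T.1 := by
  classical
  refine (Finset.sup_lt_iff Nat.card_pos).2 fun Q hQ => ?_
  obtain ⟨hQs, hQ⟩ := Finset.mem_filter.1 hQ
  have hQT : Q ≤ T := (hT.1.le_total hQs).elim id (hT.2 hQ)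
  exact lt_of_not_ge fun hcard => ne_of_mem_of_not_mem hQs hTs
    (Subtype.ext (Subgroup.eq_of_le_of_card_ge hQT hcard))

theorem card_le_insertableOrder (hQs : Q ∈ s) (hQ : IsInsertable s Q) :
    Nat.card Q.1 ≤ insertableOrder s := by
  classical
  exact Finset.le_sup (f := fun Q : PSubgroups p G => Nat.card Q.1)
    (Finset.mem_filter.2 ⟨hQs, hQ⟩)

variable [DecidableEq (PSubgroups p G)]

theorem IsInsertable.insert_self (h : IsInsertable s Q) : IsInsertable (insert Q s) Q := by
  intro P hP
  rcases Finset.mem_insert.1 hP with rfl | hP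
  exacts [.inl le_rfl, h P hP]

theorem IsInsertable.smul (g : G) (h : IsInsertable s Q) : IsInsertable (g • s) (g • Q) := by
  intro P' hP'
  obtain ⟨P, hP, rfl⟩ := Finset.mem_smul_finset.1 hP'
  exact (h P hP).imp (smul_le_smul g) (And.imp (smul_le_smul g) (coe_smul_le_stabilizer_smul g))

theorem maximal_isInsertable_smul (g : G) (h : Maximal (IsInsertable s) T) :
    Maximal (IsInsertable (g • s)) (g • T) := by
  refine ⟨h.1.smul g, fun Q hQ hTQ => ?_⟩
  have hQ' : g⁻¹ • Q ≤ T := h.2 (by simpa using hQ.smul g⁻¹) (by simpa using smul_le_smul g⁻¹ hTQ)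
  simpa using smul_le_smul g hQ'

theorem eq_of_maximal_isInsertable_insert (hT : Maximal (IsInsertable s) T)
    (hQ : Maximal (IsInsertable (insert T s)) Q) : Q = T :=
  have hQT : Q ≤ T := (hQ.1.le_total (s.mem_insert_self T)).elim
    (hT.2 (hQ.1.mono (s.subset_insert T))) id
  hQT.antisymm (hQ.2 hT.1.insert_self hQT)

-- If `S > T` is minimal among the subgroups insertable into `s.erase T`, then the normalizer of `T`
-- in `S` is insertable into `s`.
theorem maximal_isInsertable_erase [Finite G] [Fact p.Prime]
    (hs : IsChain (· ≤ ·) (s : Set (PSubgroups p G))) (hTs : T ∈ s)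
    (hT : Maximal (IsInsertable s) T) : Maximal (IsInsertable (s.erase T)) T := by
  refine ⟨hT.1.mono (s.erase_subset T), fun S₀ hS₀ hTS₀ => not_not.1 fun hS₀T => ?_⟩
  obtain ⟨S, ⟨hS, hTS⟩, hSmin⟩ := {S | IsInsertable (s.erase T) S ∧ T < S}.toFinite.exists_minimal
    ⟨S₀, hS₀, lt_of_le_not_ge hTS₀ hS₀T⟩
  have hs' : IsChain (· ≤ ·) (s.erase T : Set (PSubgroups p G)) :=
    hs.mono (Finset.coe_subset.2 (s.erase_subset T))
  obtain ⟨R, hTR, hRS, hRT⟩ := exists_lt_le_stabilizer hTS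
  refine hTR.not_ge (hT.2 (fun P hP => ?_) hTR.le)
  rcases eq_or_ne P T with rfl | hPT
  · exact .inr ⟨hTR.le, hRT⟩
  have hP' : P ∈ s.erase T := Finset.mem_erase.2 ⟨hPT, hP⟩
  rcases hS P hP' with hSP | ⟨hPS, hSstab⟩
  · exact .inl (hRS.trans hSP)
  rcases hs.total hP hTs with hle | hle
  · exact .inr ⟨hle.trans hTR.le, le_trans hRS hSstab⟩
  · exact .inl (hRS.trans (hSmin ⟨hS.of_mem_of_le hs' hP' hPS, lt_of_le_of_ne hle hPT.symm⟩ hPS))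

variable (p G) in
/-- The matching which inserts into a chain `s` a maximal insertable subgroup not in `s`. -/
noncomputable def insertionMatching [Finite G] [Fact p.Prime] [Nonempty (PSubgroups p G)] :
    EquivariantMatching G (orderComplex (PSubgroups p G)) where
  Rel s T := IsChain (· ≤ ·) (s : Set (PSubgroups p G)) ∧ T ∉ s ∧ Maximal (IsInsertable s) T
  level := insertableOrder
  insert_mem_faces {s T} := fun ⟨hs, _, hT⟩ => by
    refine ⟨Finset.insert_nonempty T s, ?_⟩
    rw [Finset.coe_insert]
    exact hs.insert fun P hP _ => (hT.1.le_total hP).symm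
  notMem h := h.2.1
  smul g _ _ := fun ⟨hs, hTs, hT⟩ => ⟨isChain_smul_finset g hs,
    by rwa [Finset.smul_mem_smul_finset_iff], maximal_isInsertable_smul g hT⟩
  exists_smul_eq hT hT' := by
    obtain ⟨g, hgs, hgT⟩ := exists_smul_eq_of_maximal_isInsertable hT.2.2 hT'.2.2
    exact ⟨g, smul_finset_eq_of_forall hgs, hgT⟩
  not_rel_insert hT hQ := hQ.2.1 <|
    eq_of_maximal_isInsertable_insert hT.2.2 hQ.2.2 ▸ Finset.mem_insert_self _ _
  level_lt hT ht hTt := (insertableOrder_lt_card hT.2.2 hT.2.1).trans_le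
    (card_le_insertableOrder hTt (hT.2.2.1.insert_self.mono ht))
  exists_rel_empty := by
    have hempty : IsChain (· ≤ ·) ((∅ : Finset (PSubgroups p G)) : Set (PSubgroups p G)) := by simp
    exact (exists_maximal_isInsertable hempty).imp fun T hT => ⟨hempty, Finset.notMem_empty T, hT⟩
  exists_rel_or_rel_erase {s} hs := by
    obtain ⟨T, hT⟩ := exists_maximal_isInsertable hs.2
    by_cases hTs : T ∈ s
    · exact .inr ⟨T, hTs, hs.2.mono (Finset.coe_subset.2 (s.erase_subset T)),
        s.notMem_erase T, maximal_isInsertable_erase hs.2 hTs hT⟩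
    · exact .inl ⟨T, hs.2, hTs, hT⟩

end PSubgroups

instance PSubgroupComplex.instIsAffineAction (p : ℕ) (G : Type*) [Group G] [Finite G] :
    IsAffineAction G (orderComplex (PSubgroups p G)) :=
  ⟨fun _ _ _ => rfl⟩

/-- The orbit space `|S_p(G)|/G`, with the quotient topology, is contractible. -/
theorem mainTheorem1 (G : Type*) [Group G] [Finite G] (p : ℕ) (hp : p.Prime)
    (hpG : p ∣ Nat.card G) :
    ContractibleSpace (MulAction.orbitRel.Quotient G (PSubgroupComplex p G)) := by
  classical
  have : Fact p.Prime := ⟨hp⟩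
  have : Nonempty (PSubgroups p G) := PSubgroups.nonempty_of_dvd_card hpG
  exact (PSubgroups.insertionMatching p G).contractibleSpace_orbitSpace
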